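/- For each $N\ge 2$ let $c^{(N)}(x,x+1)>0$, $1\le x<N$, be conductances, and put $r^{(N)}(n,m)=\sum_{x=n}^{m-1}1/c^{(N)}(x,x+1)$ for $1\le n<m\le N$. For $f:\{1,\dots,N\}\to\mathbb R$ let $$(c\nabla f)(x)=c^{(N)}(x-1,x)\,[f(x)-f(x-1)]\quad(2\le x\le N),\qquad (c\nabla f)(1)=(c\nabla f)(N+1)=0,$$ and write $\nabla f$ for $c\nabla f$ in the case of conductances all equal to $1$. Let $(\Delta^{(c)}f)(x)=(c\nabla f)(x+1)-(c\nabla f)(x)$, $1\le x\le N$, be the generator of the associated random walk. With $\mu_N$ the uniform probability measure on $\{1,\dots,N\}$ and $\langle f,g\rangle_{\mu_N}=\frac1N\sum_{x=1}^N f(x)g(x)$, its spectral gap is $$\mathrm{gap}_N=\inf_{f:\,\mathrm{Var}_{\mu_N}(f)>0}\frac{-\langle f,\Delta^{(c)}f\rangle_{\mu_N}}{\mathrm{Var}_{\mu_N}(f)},\qquad \mathrm{Var}_{\mu_N}(f)=\langle f,f\rangle_{\mu_N}-\langle f,\mathbf 1\rangle_{\mu_N}^2 .$$ Theorem 1.3.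 Assume that $$\lim_{N\to\infty}\frac1N\sup_{1\le n<m\le N}\bigl|r^{(N)}(n,m)-(m-n)\bigr|=0 .$$ Then $$\lim_{N\to\infty}\frac{N^2\,\mathrm{gap}_N}{\pi^2}=1 .$$ Furthermore, for each $N\ge2$ there is a unique function $g_1=g_1^{(N)}:\{1,\dots,N\}\to\mathbb R$ with $\Delta^{(c)}g_1=-\mathrm{gap}_N\,g_1$ and $g_1(1)=1$, and with $h(x)=\cos\bigl(\pi(x-1/2)/N\bigr)$, $1\le x\le N$, one has $$\lim_{N\to\infty}\ \sup_{1\le x\le N}\bigl|g_1(x)-h(x)\bigr|=0,\qquad \lim_{N\to\infty}\ \sup_{1\le x\le N}\bigl|N(c\nabla g_1)(x)-N(\nabla h)(x)\bigr|=0 .$$ -/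

import Mathlib

open Filter Topology

/-! Nearest-neighbour random walk with conductances on the segment `{1, …, N}`.

A conductance sequence is `c : ℕ → ℝ`, where `c x` is the conductance `c(x, x+1)` of the edge
`{x, x+1}`; only `c 1, …, c (N - 1)` are ever used.  A function on the segment is `f : ℕ → ℝ`,
of which only the values `f 1, …, f N` are ever used. -/

namespace RandomConductance

noncomputable section

/-- The weighted gradient `(c ∇ f)(x) = c(x-1, x) (f(x) - f(x-1))` for `2 ≤ x ≤ N`, with the
boundary convention `(c ∇ f)(1) = (c ∇ f)(N+1) = 0`. -/
def wgrad (N : ℕ) (c : ℕ → ℝ) (f : ℕ → ℝ) (x : ℕ) : ℝ :=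
  if 2 ≤ x ∧ x ≤ N then c (x - 1) * (f x - f (x - 1)) else 0

/-- The generator `(Δ⁽ᶜ⁾ f)(x) = (c ∇ f)(x+1) - (c ∇ f)(x)` at the sites `1 ≤ x ≤ N`. -/
def generator (N : ℕ) (c : ℕ → ℝ) (f : ℕ → ℝ) (x : ℕ) : ℝ :=
  wgrad N c f (x + 1) - wgrad N c f x

/-- The inner product of `L²` of the uniform probability measure on `{1, …, N}`. -/
def innerUnif (N : ℕ) (f g : ℕ → ℝ) : ℝ :=
  ∑ x ∈ Finset.Icc 1 N, 1 / (N : ℝ) * f x * g x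

/-- The Dirichlet form `-⟨f, Δ⁽ᶜ⁾ f⟩`. -/
def dirichlet (N : ℕ) (c : ℕ → ℝ) (f : ℕ → ℝ) : ℝ :=
  -innerUnif N f (generator N c f)

/-- The variance under the uniform probability measure on `{1, …, N}`. -/
def variance (N : ℕ) (f : ℕ → ℝ) : ℝ :=
  innerUnif N f f - innerUnif N f (fun _ => 1) ^ 2

/-- The spectral gap. For `N ≥ 2` and nonnegative conductances, the infimum is over a nonempty
set of nonnegative numbers. -/
def gap (N : ℕ) (c : ℕ → ℝ) : ℝ :=
  sInf {q : ℝ | ∃ f : ℕ → ℝ, 0 < variance N f ∧ q = dirichlet N c f / variance N f}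

/-- `g` is an eigenfunction for the spectral gap, normalised by `g 1 = 1`. -/
def IsPrincipalEigenfunction (N : ℕ) (c : ℕ → ℝ) (g : ℕ → ℝ) : Prop :=
  (∀ x ∈ Finset.Icc 1 N, generator N c g x = -gap N c * g x) ∧ g 1 = 1

/-- The resistance `r(n, m) = ∑_{x=n}^{m-1} 1 / c(x, x+1)`. -/
def resistance (c : ℕ → ℝ) (n m : ℕ) : ℝ :=
  ∑ x ∈ Finset.Ico n m, 1 / c x

/-- `δ_N = (1/N) sup_{1 ≤ n < m ≤ N} |r(n, m) - (m - n)|`. The supremum is over a finite set,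
and it is `0` if there is no such pair. -/
def resistanceDeviation (N : ℕ) (c : ℕ → ℝ) : ℝ :=
  1 / (N : ℝ) * sSup ((fun p : ℕ × ℕ => |resistance c p.1 p.2 - ((p.2 : ℝ) - (p.1 : ℝ))|) ''
    {p : ℕ × ℕ | 1 ≤ p.1 ∧ p.1 < p.2 ∧ p.2 ≤ N})

/-- `h(x) = cos (π (x - 1/2) / N)`. -/
def cosProfile (N : ℕ) (x : ℕ) : ℝ :=
  Real.cos (Real.pi * ((x : ℝ) - 1 / 2) / (N : ℝ))

/-- The supremum of `|u|` over the sites `{1, …, N}`. -/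
def supSites (N : ℕ) (u : ℕ → ℝ) : ℝ :=
  sSup ((fun x => |u x|) '' Set.Icc 1 N)

end

end RandomConductance

namespace RandomConductance

/-! Write δ for the resistance deviation. The hypothesis controls only sums of 1/c - 1 over
intervals (at most Nδ in absolute value), not individual terms. Such sums are therefore always
paired with slowly varying weights and estimated by Abel summation (`abs_sum_mul_le`).

Upper bound: take the test function whose flux c∇ equals the gradient of the cosine. Its energy and
variance differ from those of the cosine by errors that vanish with δ, so N² gap is at most
`gapBound` δ, which tends to π² (`sq_mul_gap_le`).

The lower bound uses the eigenfunction itself. Summed once, the eigenvalue equation becomes a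
recursion with memory, in which the flux is -gap times a partial sum of g. For unit conductances and
the same eigenvalue gap = 4 sin²(θ/2), the solution starting at 1 is cos(θ(x - 1/2)) / cos(θ/2). As
N² gap is bounded, a Grönwall argument puts g uniformly close to it (`abs_eigenfunction_sub_le`).
Since g has mean zero, sin(Nθ) is at most a vanishing multiple of Nθ (`abs_sin_gapAngle_le`). The
function sinc is positive on [0, π), and Nθ is asymptotically at most π, so Nθ tends to π
(`tendsto_pi_of_sinc`).

This gives the limit of the gap and of g. The gradients follow from the summed equation, where the
conductances no longer appear. -/

/-! ### Dirichlet form and variance. -/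

theorem wgrad_one (N : ℕ) (c f : ℕ → ℝ) : wgrad N c f 1 = 0 := by
  simp [wgrad]

theorem wgrad_last (N : ℕ) (c f : ℕ → ℝ) : wgrad N c f (N + 1) = 0 := by
  simp [wgrad]

theorem wgrad_succ {N x : ℕ} (c f : ℕ → ℝ) (h1 : 1 ≤ x) (h2 : x < N) :
    wgrad N c f (x + 1) = c x * (f (x + 1) - f x) := by
  have h : 2 ≤ x + 1 ∧ x + 1 ≤ N := by omega
  simp [wgrad, h]

theorem innerUnif_eq (N : ℕ) (f g : ℕ → ℝ) :
    innerUnif N f g = 1 / (N : ℝ) * ∑ x ∈ Finset.Icc 1 N, f x * g x := by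
  simp only [innerUnif, Finset.mul_sum, mul_assoc]

theorem variance_eq (N : ℕ) (f : ℕ → ℝ) :
    variance N f = 1 / (N : ℝ) * ∑ x ∈ Finset.Icc 1 N, f x ^ 2 -
      (1 / (N : ℝ) * ∑ x ∈ Finset.Icc 1 N, f x) ^ 2 := by
  simp only [variance, innerUnif_eq, mul_one, sq]

/-- Summation by parts against the differences of `w`. -/
theorem sum_mul_sub_by_parts (g w : ℕ → ℝ) {m : ℕ} (hm : 1 ≤ m) :
    ∑ x ∈ Finset.Icc 1 m, g x * (w (x + 1) - w x) =
      g m * w (m + 1) - g 1 * w 1 - ∑ y ∈ Finset.Ico 1 m, w (y + 1) * (g (y + 1) - g y) := by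
  induction m, hm using Nat.le_induction with
  | base => simp; ring
  | succ m hm ih =>
    rw [Finset.sum_Icc_succ_top (by omega), Finset.sum_Ico_succ_top hm, ih]
    ring

theorem neg_innerUnif_generator {N : ℕ} (hN : 1 ≤ N) (c f g : ℕ → ℝ) :
    -innerUnif N g (generator N c f) =
      1 / (N : ℝ) * ∑ y ∈ Finset.Ico 1 N, c y * (f (y + 1) - f y) * (g (y + 1) - g y) := by
  have h := sum_mul_sub_by_parts g (wgrad N c f) hN
  rw [wgrad_last, wgrad_one] at h
  rw [innerUnif_eq]
  simp only [generator]
  rw [h, Finset.sum_congr rfl (g := fun y => c y * (f (y + 1) - f y) * (g (y + 1) - g y))]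
  · ring
  · intro y hy
    rw [Finset.mem_Ico] at hy
    rw [wgrad_succ c f hy.1 hy.2]

theorem dirichlet_eq {N : ℕ} (hN : 1 ≤ N) (c f : ℕ → ℝ) :
    dirichlet N c f = 1 / (N : ℝ) * ∑ y ∈ Finset.Ico 1 N, c y * (f (y + 1) - f y) ^ 2 := by
  rw [dirichlet, neg_innerUnif_generator hN]
  simp only [sq, mul_assoc]

theorem dirichlet_nonneg {N : ℕ} (hN : 1 ≤ N) {c : ℕ → ℝ}
    (hc : ∀ x, 1 ≤ x → x < N → 0 < c x) (f : ℕ → ℝ) : 0 ≤ dirichlet N c f := by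
  rw [dirichlet_eq hN]
  refine mul_nonneg (by positivity) (Finset.sum_nonneg fun y hy => ?_)
  rw [Finset.mem_Ico] at hy
  exact mul_nonneg (hc y hy.1 hy.2).le (sq_nonneg _)

theorem variance_sub_const {N : ℕ} (hN : 1 ≤ N) (f : ℕ → ℝ) (a : ℝ) :
    variance N (fun x => f x - a) = variance N f := by
  have h0 : (N : ℝ) ≠ 0 := by positivity
  simp only [variance_eq, sub_sq, Finset.sum_add_distrib, Finset.sum_sub_distrib,
    Finset.sum_const, Nat.card_Icc, nsmul_eq_mul, ← Finset.sum_mul, ← Finset.mul_sum]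
  push_cast [Nat.add_sub_cancel]
  field_simp
  ring

theorem variance_nonneg {N : ℕ} (hN : 1 ≤ N) (f : ℕ → ℝ) : 0 ≤ variance N f := by
  have h0 : (N : ℝ) ≠ 0 := by positivity
  rw [← variance_sub_const hN f (1 / (N : ℝ) * ∑ x ∈ Finset.Icc 1 N, f x), variance_eq]
  have : ∑ x ∈ Finset.Icc 1 N, (f x - 1 / (N : ℝ) * ∑ x ∈ Finset.Icc 1 N, f x) = 0 := by
    simp only [Finset.sum_sub_distrib, Finset.sum_const, Nat.card_Icc, nsmul_eq_mul]
    push_cast [Nat.add_sub_cancel]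
    field_simp
    ring
  rw [this]
  have : 0 ≤ ∑ x ∈ Finset.Icc 1 N, (f x - 1 / (N : ℝ) * ∑ x ∈ Finset.Icc 1 N, f x) ^ 2 :=
    Finset.sum_nonneg fun _ _ => sq_nonneg _
  simp only [mul_zero, ne_eq, OfNat.ofNat_ne_zero, not_false_eq_true, zero_pow, sub_zero]
  positivity

/-! ### The eigenvalue equation as a recursion. -/

/-- Integrated form of the eigenvalue equation. -/
theorem wgrad_eq_neg_mul_sum {N : ℕ} {c f : ℕ → ℝ} {μ : ℝ}
    (h : ∀ x ∈ Finset.Icc 1 N, generator N c f x = -μ * f x) {x : ℕ} (hx : x ≤ N) :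
    wgrad N c f (x + 1) = -μ * ∑ z ∈ Finset.Icc 1 x, f z := by
  induction x with
  | zero => simp [wgrad_one]
  | succ x ih =>
    have h1 := h (x + 1) (Finset.mem_Icc.2 ⟨by omega, hx⟩)
    rw [generator, ih (by omega)] at h1
    rw [Finset.sum_Icc_succ_top (by omega)]
    linarith

theorem eigenfunction_succ {N : ℕ} {c f : ℕ → ℝ} {μ : ℝ}
    (hc : ∀ x, 1 ≤ x → x < N → 0 < c x)
    (h : ∀ x ∈ Finset.Icc 1 N, generator N c f x = -μ * f x) {x : ℕ} (h1 : 1 ≤ x) (h2 : x < N) :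
    f (x + 1) = f x + 1 / c x * (-μ * ∑ z ∈ Finset.Icc 1 x, f z) := by
  rw [← wgrad_eq_neg_mul_sum h h2.le, wgrad_succ c f h1 h2]
  have := (hc x h1 h2).ne'
  field_simp
  ring

theorem eigenfunction_unique {N : ℕ} {c f g : ℕ → ℝ} {μ : ℝ}
    (hc : ∀ x, 1 ≤ x → x < N → 0 < c x)
    (hf : ∀ x ∈ Finset.Icc 1 N, generator N c f x = -μ * f x)
    (hg : ∀ x ∈ Finset.Icc 1 N, generator N c g x = -μ * g x) (h1 : f 1 = g 1) {x : ℕ}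
    (hx : x ∈ Finset.Icc 1 N) : f x = g x := by
  induction x using Nat.strong_induction_on with
  | _ x ih =>
    rw [Finset.mem_Icc] at hx
    obtain rfl | h2 := hx.1.eq_or_lt
    · exact h1
    · obtain ⟨y, rfl⟩ : ∃ y, x = y + 1 := ⟨x - 1, by omega⟩
      rw [eigenfunction_succ hc hf (by omega) (by omega),
        eigenfunction_succ hc hg (by omega) (by omega),
        ih y (by omega) (Finset.mem_Icc.2 (by omega)), Finset.sum_congr rfl fun z hz => ?_]
      rw [Finset.mem_Icc] at hz
      exact ih z (by omega) (Finset.mem_Icc.2 (by omega))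

/-! ### Existence of a gap eigenfunction. -/

theorem exists_normalized {N : ℕ} (hN : 1 ≤ N) (c : ℕ → ℝ) {f : ℕ → ℝ} (hf : 0 < variance N f) :
    ∃ g : ℕ → ℝ, (∀ x, g x ∈ Set.Icc (-1 : ℝ) 1) ∧ ∑ x ∈ Finset.Icc 1 N, g x = 0 ∧
      ∑ x ∈ Finset.Icc 1 N, g x ^ 2 = 1 ∧ N * dirichlet N c g = dirichlet N c f / variance N f := by
  have h0 : (N : ℝ) ≠ 0 := by positivity
  set a := 1 / (N : ℝ) * ∑ x ∈ Finset.Icc 1 N, f x with ha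
  set S := ∑ x ∈ Finset.Icc 1 N, (f x - a) ^ 2 with hS
  have hsum : ∑ x ∈ Finset.Icc 1 N, (f x - a) = 0 := by
    simp only [Finset.sum_sub_distrib, Finset.sum_const, Nat.card_Icc, nsmul_eq_mul]
    push_cast [Nat.add_sub_cancel]
    rw [ha]
    field_simp
    ring
  have hv : variance N f = S / N := by
    rw [← variance_sub_const hN f a, variance_eq, hsum, ← hS]
    ring
  have hSpos : 0 < S := by
    rw [hv] at hf
    by_contra hcon
    exact absurd (div_nonpos_of_nonpos_of_nonneg (not_lt.1 hcon) (Nat.cast_nonneg N)) (not_le.2 hf)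
  have hq := Real.sqrt_pos.2 hSpos
  have hqq := Real.sq_sqrt hSpos.le
  -- Cutting off outside the segment keeps every coordinate in [-1, 1], so that `g` lies in a
  -- compact product of intervals.
  let g : ℕ → ℝ := fun x => if x ∈ Finset.Icc 1 N then (f x - a) / √S else 0
  have hg : ∀ x ∈ Finset.Icc 1 N, g x = (f x - a) / √S := fun x hx => if_pos hx
  have hgs : ∑ x ∈ Finset.Icc 1 N, g x ^ 2 = 1 := by
    rw [Finset.sum_congr rfl fun x hx => by rw [hg x hx, div_pow, hqq], ← Finset.sum_div]
    exact div_self hSpos.ne'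
  refine ⟨g, fun x => ?_, ?_, hgs, ?_⟩
  · by_cases hx : x ∈ Finset.Icc 1 N
    · rw [Set.mem_Icc, ← abs_le, ← sq_le_one_iff_abs_le_one, ← hgs]
      exact Finset.single_le_sum (f := fun x => g x ^ 2) (fun _ _ => sq_nonneg _) hx
    · rw [show g x = 0 from if_neg hx]
      norm_num
  · rw [Finset.sum_congr rfl hg, ← Finset.sum_div, hsum, zero_div]
  · rw [dirichlet_eq hN, dirichlet_eq hN, hv, Finset.sum_congr rfl
      (g := fun y => c y * (f (y + 1) - f y) ^ 2 / S)]
    · rw [← Finset.sum_div]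
      field_simp
    · intro y hy
      rw [Finset.mem_Ico] at hy
      rw [hg y (Finset.mem_Icc.2 (by omega)), hg (y + 1) (Finset.mem_Icc.2 (by omega)),
        ← sub_div, div_pow, hqq]
      ring

theorem exists_variance_pos {N : ℕ} (hN : 2 ≤ N) : ∃ f : ℕ → ℝ, 0 < variance N f := by
  refine ⟨fun x => if x = 1 then 1 else 0, ?_⟩
  have h2 : (2 : ℝ) ≤ N := by exact_mod_cast hN
  have h1 : 1 ≤ N := by omega
  simp only [variance_eq, ite_pow, one_pow, ne_eq, OfNat.ofNat_ne_zero, not_false_eq_true,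
    zero_pow, Finset.sum_ite_eq', Finset.mem_Icc, le_refl, h1, and_self, if_true, mul_one]
  have : 1 / (N : ℝ) < 1 := by rw [div_lt_one] <;> linarith
  have h3 : 0 < 1 / (N : ℝ) := by positivity
  nlinarith

/-- The infimum defining the gap is attained. -/
theorem exists_minimizer {N : ℕ} (hN : 2 ≤ N) (c : ℕ → ℝ) :
    ∃ f : ℕ → ℝ, ∑ x ∈ Finset.Icc 1 N, f x = 0 ∧ ∑ x ∈ Finset.Icc 1 N, f x ^ 2 = 1 ∧
      gap N c = N * dirichlet N c f ∧
      ∀ g, 0 < variance N g → gap N c ≤ dirichlet N c g / variance N g := by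
  have hN1 : 1 ≤ N := by omega
  have h0 : (N : ℝ) ≠ 0 := by positivity
  -- Compact by Tychonoff, although functions live on all of ℕ; the constraints and the energy
  -- involve finitely many coordinates.
  set K : Set (ℕ → ℝ) := (Set.univ.pi fun _ => Set.Icc (-1 : ℝ) 1) ∩
    {f | ∑ x ∈ Finset.Icc 1 N, f x = 0 ∧ ∑ x ∈ Finset.Icc 1 N, f x ^ 2 = 1} with hK
  have hKc : IsCompact K := by
    refine (isCompact_univ_pi fun _ => isCompact_Icc).inter_right (IsClosed.inter ?_ ?_)
    · exact isClosed_eq (by fun_prop) continuous_const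
    · exact isClosed_eq (by fun_prop) continuous_const
  obtain ⟨f₁, hf₁⟩ := exists_variance_pos hN
  obtain ⟨g₁, h1, h2, h3, -⟩ := exists_normalized hN1 c hf₁
  have hcont : Continuous fun f : ℕ → ℝ => (N : ℝ) * dirichlet N c f := by
    simp only [dirichlet_eq hN1]
    fun_prop
  obtain ⟨f, hfK, hfmin⟩ := hKc.exists_isMinOn ⟨g₁, fun x _ => h1 x, h2, h3⟩ hcont.continuousOn
  have hle : ∀ g, 0 < variance N g → N * dirichlet N c f ≤ dirichlet N c g / variance N g := by
    intro g hg
    obtain ⟨g', h1, h2, h3, h4⟩ := exists_normalized hN1 c hg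
    rw [← h4]
    exact hfmin ⟨fun x _ => h1 x, h2, h3⟩
  have hv : variance N f = 1 / N := by
    rw [variance_eq, hfK.2.1, hfK.2.2]
    ring
  have hleast : IsLeast {q : ℝ | ∃ f : ℕ → ℝ, 0 < variance N f ∧
      q = dirichlet N c f / variance N f} (N * dirichlet N c f) := by
    refine ⟨⟨f, ?_, ?_⟩, ?_⟩
    · rw [hv]; positivity
    · rw [hv]; field_simp
    · rintro q ⟨g, hg, rfl⟩
      exact hle g hg
  have hgap : gap N c = N * dirichlet N c f := hleast.csInf_eq
  exact ⟨f, hfK.2.1, hfK.2.2, hgap, fun g hg => hgap ▸ hle g hg⟩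

theorem eq_zero_of_forall_quadratic_nonneg {b q : ℝ} (h : ∀ t : ℝ, 0 ≤ 2 * t * b + t ^ 2 * q) :
    b = 0 := by
  have := discrim_le_zero (a := q) (b := 2 * b) (c := 0) fun t => by linarith [h t]
  rw [discrim] at this
  nlinarith [sq_nonneg b]

/-- A minimiser of the Rayleigh quotient is an eigenfunction. -/
theorem exists_gap_eigenfunction {N : ℕ} (hN : 2 ≤ N) {c : ℕ → ℝ}
    (hc : ∀ x, 1 ≤ x → x < N → 0 < c x) :
    ∃ f : ℕ → ℝ, ∑ x ∈ Finset.Icc 1 N, f x = 0 ∧ ∑ x ∈ Finset.Icc 1 N, f x ^ 2 = 1 ∧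
      0 ≤ gap N c ∧ ∀ x ∈ Finset.Icc 1 N, generator N c f x = -gap N c * f x := by
  have hN1 : 1 ≤ N := by omega
  have h0 : (N : ℝ) ≠ 0 := by positivity
  obtain ⟨f, hf0, hf1, hgap, hmin⟩ := exists_minimizer hN c
  refine ⟨f, hf0, hf1, ?_, fun x hx => ?_⟩
  · rw [hgap]
    exact mul_nonneg (Nat.cast_nonneg N) (dirichlet_nonneg hN1 hc f)
  have hQ : ∀ g, 0 ≤ dirichlet N c g - gap N c * variance N g := by
    intro g
    rcases (variance_nonneg hN1 g).eq_or_lt with hv | hv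
    · rw [← hv]
      simpa using dirichlet_nonneg hN1 hc g
    · have := (le_div_iff₀ hv).1 (hmin g hv)
      linarith
  -- First variation: the nonnegative form dirichlet - gap · variance vanishes at `f`, so its cross
  -- term with any `g` vanishes.
  have hvar : ∀ (g : ℕ → ℝ), -innerUnif N g (generator N c f) - gap N c * innerUnif N f g = 0 := by
    intro g
    apply eq_zero_of_forall_quadratic_nonneg (q := dirichlet N c g - gap N c * variance N g)
    intro t
    have h1 := hQ fun x => f x + t * g x
    have h2 : dirichlet N c (fun x => f x + t * g x) = dirichlet N c f +
        2 * t * -innerUnif N g (generator N c f) + t ^ 2 * dirichlet N c g := by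
      simp only [dirichlet_eq hN1, neg_innerUnif_generator hN1, Finset.mul_sum,
        ← Finset.sum_add_distrib]
      exact Finset.sum_congr rfl fun y _ => by ring
    have h3 : variance N (fun x => f x + t * g x) = variance N f +
        2 * t * innerUnif N f g + t ^ 2 * variance N g := by
      have e1 : ∑ x ∈ Finset.Icc 1 N, (f x + t * g x) = t * ∑ x ∈ Finset.Icc 1 N, g x := by
        rw [Finset.sum_add_distrib, hf0, zero_add, Finset.mul_sum]
      have e2 : ∑ x ∈ Finset.Icc 1 N, (f x + t * g x) ^ 2 = ∑ x ∈ Finset.Icc 1 N, f x ^ 2 +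
          2 * t * ∑ x ∈ Finset.Icc 1 N, f x * g x + t ^ 2 * ∑ x ∈ Finset.Icc 1 N, g x ^ 2 := by
        simp only [Finset.mul_sum, ← Finset.sum_add_distrib]
        exact Finset.sum_congr rfl fun y _ => by ring
      rw [variance_eq, variance_eq, variance_eq, innerUnif_eq, e1, e2, hf0]
      ring
    have h4 : gap N c * variance N f = dirichlet N c f := by
      rw [variance_eq, hf0, hf1, hgap]
      field_simp
      ring
    rw [h2, h3] at h1
    linarith
  have h1 := hvar fun y => if y = x then 1 else 0
  simp only [innerUnif_eq, ite_mul, mul_ite, one_mul, zero_mul, mul_one, mul_zero,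
    Finset.sum_ite_eq', hx, if_true] at h1
  field_simp at h1
  linarith

/-- At eigenvalue zero the recursion only produces constants, and a constant of mean zero cannot
have norm one. -/
theorem gap_pos {N : ℕ} (hN : 2 ≤ N) {c : ℕ → ℝ} (hc : ∀ x, 1 ≤ x → x < N → 0 < c x) :
    0 < gap N c := by
  obtain ⟨f, hf0, hf1, hg, hf⟩ := exists_gap_eigenfunction hN hc
  refine lt_of_le_of_ne hg fun hzero => ?_
  have hconst : ∀ x ∈ Finset.Icc 1 N, f x = f 1 := fun x hx =>
    eigenfunction_unique (g := fun _ => f 1) (μ := gap N c) hc hf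
      (fun y _ => by simp [generator, wgrad, ← hzero]) rfl hx
  rw [Finset.sum_congr rfl hconst] at hf0
  have h1 : f 1 = 0 := by simpa [show N ≠ 0 by omega] using hf0
  rw [Finset.sum_congr rfl fun x hx => by rw [hconst x hx, h1]] at hf1
  simp at hf1

theorem exists_principalEigenfunction {N : ℕ} (hN : 2 ≤ N) {c : ℕ → ℝ}
    (hc : ∀ x, 1 ≤ x → x < N → 0 < c x) : ∃ g, IsPrincipalEigenfunction N c g := by
  obtain ⟨f, hf0, hf1, hg, hf⟩ := exists_gap_eigenfunction hN hc
  have h1 : f 1 ≠ 0 := by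
    intro h1
    have hz : ∀ x ∈ Finset.Icc 1 N, f x = 0 := fun x hx =>
      eigenfunction_unique (g := fun _ => 0) (μ := gap N c) hc hf
        (fun y _ => by simp [generator, wgrad]) h1 hx
    rw [Finset.sum_congr rfl fun x hx => by rw [hz x hx]] at hf1
    simp at hf1
  refine ⟨fun x => f x / f 1, fun x hx => ?_, div_self h1⟩
  have h2 : ∀ y, wgrad N c (fun x => f x / f 1) y = wgrad N c f y / f 1 := by
    intro y
    simp only [wgrad]
    split_ifs
    · ring
    · simp
  rw [generator, h2, h2, ← sub_div, ← generator, hf x hx]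
  ring

/-- The flux through the right end is zero and equals -gap times the total sum. -/
theorem IsPrincipalEigenfunction.sum_eq_zero {N : ℕ} (hN : 2 ≤ N) {c g : ℕ → ℝ}
    (hc : ∀ x, 1 ≤ x → x < N → 0 < c x) (hg : IsPrincipalEigenfunction N c g) :
    ∑ x ∈ Finset.Icc 1 N, g x = 0 := by
  have h := wgrad_eq_neg_mul_sum hg.1 le_rfl
  rw [wgrad_last] at h
  have := gap_pos hN hc
  rcases mul_eq_zero.1 h.symm with h | h
  · linarith
  · exact h

/-! ### Resistance deviation and Abel summation. -/

theorem resistanceDeviation_nonneg (N : ℕ) (c : ℕ → ℝ) : 0 ≤ resistanceDeviation N c := by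
  refine mul_nonneg (by positivity) (Real.sSup_nonneg ?_)
  rintro _ ⟨p, -, rfl⟩
  exact abs_nonneg _

theorem abs_sum_resistance_sub_one_le {N m : ℕ} (c : ℕ → ℝ) (hm : m ≤ N) :
    |∑ y ∈ Finset.Ico 1 m, (1 / c y - 1)| ≤ N * resistanceDeviation N c := by
  rcases le_or_gt m 1 with h | h
  · rw [Finset.Ico_eq_empty (by omega), Finset.sum_empty, abs_zero]
    exact mul_nonneg (Nat.cast_nonneg N) (resistanceDeviation_nonneg N c)
  have hN : (N : ℝ) ≠ 0 := by
    have : N ≠ 0 := by omega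
    exact_mod_cast this
  have hfin : {p : ℕ × ℕ | 1 ≤ p.1 ∧ p.1 < p.2 ∧ p.2 ≤ N}.Finite :=
    (Set.finite_Icc ((1, 1) : ℕ × ℕ) (N, N)).subset fun p hp => by
      simp only [Set.mem_ofPred_eq] at hp
      exact ⟨⟨by omega, by omega⟩, ⟨by omega, by omega⟩⟩
  rw [resistanceDeviation, ← mul_assoc, mul_one_div_cancel hN, one_mul]
  refine le_csSup (hfin.image _).bddAbove ⟨(1, m), ⟨le_rfl, h, hm⟩, ?_⟩
  simp only [resistance, Finset.sum_sub_distrib, Finset.sum_const, Nat.card_Ico, nsmul_eq_mul,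
    mul_one]
  rw [Nat.cast_sub h.le]

/-- Abel summation bound: small partial sums of `a` against `φ` of bounded variation. -/
theorem abs_sum_mul_le {N : ℕ} {a φ : ℕ → ℝ} {M B L : ℝ}
    (hM : ∀ m ≤ N, |∑ y ∈ Finset.Ico 1 m, a y| ≤ M)
    (hB : ∀ y, 1 ≤ y → y < N → |φ y| ≤ B)
    (hL : ∀ y, 1 ≤ y → y + 1 < N → |φ (y + 1) - φ y| ≤ L) (hB0 : 0 ≤ B) (hL0 : 0 ≤ L)
    {m : ℕ} (hm : m ≤ N) :
    |∑ y ∈ Finset.Ico 1 m, a y * φ y| ≤ M * (B + N * L) := by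
  have hM0 : 0 ≤ M := (abs_nonneg _).trans (hM m hm)
  obtain h | ⟨n, rfl, hn⟩ : m ≤ 1 ∨ ∃ n, m = n + 1 ∧ 1 ≤ n := by
    rcases le_or_gt m 1 with h | h
    · exact Or.inl h
    · exact Or.inr ⟨m - 1, by omega, by omega⟩
  · rw [Finset.Ico_eq_empty (by omega), Finset.sum_empty, abs_zero]
    positivity
  -- The boundary term uses φ at `n`, the last index summed: nothing is assumed about φ at `N`.
  have key : ∑ y ∈ Finset.Ico 1 (n + 1), a y * φ y = (∑ y ∈ Finset.Ico 1 (n + 1), a y) * φ n -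
      ∑ y ∈ Finset.Ico 1 n, (∑ z ∈ Finset.Ico 1 (y + 1), a z) * (φ (y + 1) - φ y) := by
    clear hm
    induction n, hn using Nat.le_induction with
    | base => simp
    | succ n hn ih =>
      rw [Finset.sum_Ico_succ_top (by omega), ih, Finset.sum_Ico_succ_top (b := n + 1) (by omega),
        Finset.sum_Ico_succ_top (b := n) hn
          (f := fun y => (∑ z ∈ Finset.Ico 1 (y + 1), a z) * (φ (y + 1) - φ y))]
      ring
  have h1 : |(∑ y ∈ Finset.Ico 1 (n + 1), a y) * φ n| ≤ M * B := by
    rw [abs_mul]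
    exact mul_le_mul (hM _ hm) (hB n hn (by omega)) (abs_nonneg _) hM0
  have h2 : |∑ y ∈ Finset.Ico 1 n, (∑ z ∈ Finset.Ico 1 (y + 1), a z) * (φ (y + 1) - φ y)| ≤
      N * (M * L) := by
    refine (Finset.abs_sum_le_sum_abs _ _).trans
      ((Finset.sum_le_card_nsmul _ _ (M * L) fun y hy => ?_).trans ?_)
    · rw [Finset.mem_Ico] at hy
      rw [abs_mul]
      exact mul_le_mul (hM _ (by omega)) (hL y hy.1 (by omega)) (abs_nonneg _) hM0
    · rw [nsmul_eq_mul, Nat.card_Ico]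
      have : ((n - 1 : ℕ) : ℝ) ≤ N := by exact_mod_cast (by omega : n - 1 ≤ N)
      gcongr
  rw [key]
  calc _ ≤ _ := abs_sub _ _
    _ ≤ M * B + N * (M * L) := add_le_add h1 h2
    _ = _ := by ring

/-! ### The cosine and unit conductances. -/

/-- Each term telescopes, as 2 sin(θ/2) cos(θ(z - 1/2)) = sin(θz) - sin(θ(z - 1)). -/
theorem two_sin_mul_sum_cos (θ : ℝ) (n : ℕ) :
    2 * Real.sin (θ / 2) * ∑ z ∈ Finset.Icc 1 n, Real.cos (θ * ((z : ℝ) - 1 / 2)) =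
      Real.sin (θ * n) := by
  induction n with
  | zero => simp
  | succ n ih =>
    rw [Finset.sum_Icc_succ_top (by omega), mul_add, ih]
    have := Real.sin_sub_sin (θ * ((n : ℝ) + 1)) (θ * n)
    rw [show (θ * ((n : ℝ) + 1) - θ * n) / 2 = θ / 2 by ring,
      show (θ * ((n : ℝ) + 1) + θ * n) / 2 = θ * ((n : ℝ) + 1 - 1 / 2) by ring] at this
    push_cast
    linarith

theorem cos_succ_sub (θ : ℝ) (n : ℕ) :
    Real.cos (θ * (((n + 1 : ℕ) : ℝ) - 1 / 2)) - Real.cos (θ * ((n : ℝ) - 1 / 2)) =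
      -2 * Real.sin (θ / 2) * Real.sin (θ * n) := by
  rw [Real.cos_sub_cos]
  push_cast
  rw [show (θ * ((n : ℝ) + 1 - 1 / 2) + θ * ((n : ℝ) - 1 / 2)) / 2 = θ * n by ring,
    show (θ * ((n : ℝ) + 1 - 1 / 2) - θ * ((n : ℝ) - 1 / 2)) / 2 = θ / 2 by ring]
  ring

/-- The cosine solves the eigenvalue equation for unit conductances. -/
theorem cos_succ_sub_eq_sum (θ : ℝ) (n : ℕ) :
    Real.cos (θ * (((n + 1 : ℕ) : ℝ) - 1 / 2)) - Real.cos (θ * ((n : ℝ) - 1 / 2)) =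
      -(4 * Real.sin (θ / 2) ^ 2) *
        ∑ z ∈ Finset.Icc 1 n, Real.cos (θ * ((z : ℝ) - 1 / 2)) := by
  rw [cos_succ_sub, ← two_sin_mul_sum_cos]
  ring

theorem cosProfile_eq (N x : ℕ) :
    cosProfile N x = Real.cos (Real.pi / N * ((x : ℝ) - 1 / 2)) := by
  rw [cosProfile]
  congr 1
  ring

/-- The spectral gap for unit conductances. -/
noncomputable def unitGap (N : ℕ) : ℝ := 4 * Real.sin (Real.pi / N / 2) ^ 2

theorem unitGap_nonneg (N : ℕ) : 0 ≤ unitGap N := by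
  unfold unitGap; positivity

theorem sq_mul_unitGap_le (N : ℕ) : (N : ℝ) ^ 2 * unitGap N ≤ Real.pi ^ 2 := by
  rcases N.eq_zero_or_pos with rfl | hN
  · simp; positivity
  have h0 : (0 : ℝ) < N := by exact_mod_cast hN
  have h : |Real.sin (Real.pi / N / 2)| ≤ Real.pi / N / 2 :=
    Real.abs_sin_le_abs.trans_eq (abs_of_nonneg (by positivity))
  have h2 : Real.sin (Real.pi / N / 2) ^ 2 ≤ (Real.pi / N / 2) ^ 2 := sq_le_sq' (by
    linarith [neg_abs_le (Real.sin (Real.pi / N / 2))]) ((le_abs_self _).trans h)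
  calc (N : ℝ) ^ 2 * unitGap N ≤ (N : ℝ) ^ 2 * (4 * (Real.pi / N / 2) ^ 2) := by
        unfold unitGap; gcongr
    _ = Real.pi ^ 2 := by field_simp; ring

theorem cosProfile_succ_sub (N n : ℕ) :
    cosProfile N (n + 1) - cosProfile N n =
      -unitGap N * ∑ z ∈ Finset.Icc 1 n, cosProfile N z := by
  simp only [cosProfile_eq, unitGap]
  exact cos_succ_sub_eq_sum _ n

theorem sin_pi_div_pos {N : ℕ} (hN : 2 ≤ N) : 0 < Real.sin (Real.pi / N) := by
  have h2 : (2 : ℝ) ≤ N := by exact_mod_cast hN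
  refine Real.sin_pos_of_pos_of_lt_pi (by positivity) ?_
  rw [div_lt_iff₀ (by positivity)]
  nlinarith [Real.pi_pos]

theorem sin_pi_div_two_pos {N : ℕ} (hN : 2 ≤ N) : 0 < Real.sin (Real.pi / N / 2) := by
  have h2 : (2 : ℝ) ≤ N := by exact_mod_cast hN
  refine Real.sin_pos_of_pos_of_lt_pi (by positivity) ?_
  rw [div_div, div_lt_iff₀ (by positivity)]
  nlinarith [Real.pi_pos]

theorem sum_cosProfile {N : ℕ} (hN : 2 ≤ N) : ∑ z ∈ Finset.Icc 1 N, cosProfile N z = 0 := by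
  have h0 : (N : ℝ) ≠ 0 := by positivity
  have h := two_sin_mul_sum_cos (Real.pi / N) N
  rw [div_mul_cancel₀ _ h0, Real.sin_pi] at h
  simp only [cosProfile_eq]
  exact (mul_eq_zero.1 h).resolve_left (by linarith [sin_pi_div_two_pos hN])

/-- Halving cos² leaves a cosine sum at the doubled angle 2π/N, which vanishes. -/
theorem sum_cosProfile_sq {N : ℕ} (hN : 2 ≤ N) :
    ∑ z ∈ Finset.Icc 1 N, cosProfile N z ^ 2 = N / 2 := by
  have h0 : (N : ℝ) ≠ 0 := by positivity
  have h := two_sin_mul_sum_cos (2 * (Real.pi / N)) N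
  rw [mul_assoc 2 (Real.pi / N), div_mul_cancel₀ _ h0, Real.sin_two_pi,
    mul_div_cancel_left₀ _ (two_ne_zero' ℝ)] at h
  have h1 := (mul_eq_zero.1 h).resolve_left (by linarith [sin_pi_div_pos hN])
  simp only [cosProfile_eq, Real.cos_sq, Finset.sum_add_distrib, ← Finset.sum_div, ← mul_assoc]
  rw [h1]
  simp

theorem abs_cosProfile_le (N x : ℕ) : |cosProfile N x| ≤ 1 := Real.abs_cos_le_one _

theorem abs_sum_Icc_le {N n : ℕ} {g : ℕ → ℝ} {B : ℝ} (hn : n ≤ N) (hB : 0 ≤ B)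
    (h : ∀ x, 1 ≤ x → x ≤ n → |g x| ≤ B) : |∑ z ∈ Finset.Icc 1 n, g z| ≤ N * B := by
  refine (Finset.abs_sum_le_sum_abs _ _).trans
    ((Finset.sum_le_card_nsmul _ _ B fun y hy => ?_).trans ?_)
  · rw [Finset.mem_Icc] at hy
    exact h y hy.1 hy.2
  · rw [nsmul_eq_mul, Nat.card_Icc, Nat.add_sub_cancel]
    gcongr

theorem eq_add_sum_sub (f : ℕ → ℝ) {x : ℕ} (hx : 1 ≤ x) :
    f x = f 1 + ∑ y ∈ Finset.Ico 1 x, (f (y + 1) - f y) := by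
  rw [Finset.sum_Ico_sub f hx]
  ring

/-! ### Upper bound for the gap. -/

/-- The cosine profile, transported to the conductances `c`, as a test function. -/
noncomputable def testFunction (N : ℕ) (c : ℕ → ℝ) (x : ℕ) : ℝ :=
  cosProfile N 1 + ∑ y ∈ Finset.Ico 1 x, 1 / c y * (cosProfile N (y + 1) - cosProfile N y)

theorem abs_cosProfile_succ_sub_le {N y : ℕ} (hy : y ≤ N) :
    |cosProfile N (y + 1) - cosProfile N y| ≤ N * unitGap N := by
  rw [cosProfile_succ_sub, abs_mul, abs_neg, abs_of_nonneg (unitGap_nonneg N), mul_comm]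
  refine mul_le_mul_of_nonneg_right ?_ (unitGap_nonneg N)
  simpa using abs_sum_Icc_le hy zero_le_one fun x _ _ => abs_cosProfile_le N x

theorem abs_cosProfile_second_difference_le (N y : ℕ) :
    |(cosProfile N (y + 1 + 1) - cosProfile N (y + 1)) - (cosProfile N (y + 1) - cosProfile N y)| ≤
      unitGap N := by
  rw [cosProfile_succ_sub, cosProfile_succ_sub, Finset.sum_Icc_succ_top (by omega),
    show ∀ a b k : ℝ, -k * (a + b) - -k * a = -k * b by intros; ring, abs_mul, abs_neg,
    abs_of_nonneg (unitGap_nonneg N)]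
  exact mul_le_of_le_one_right (unitGap_nonneg N) (abs_cosProfile_le _ _)

/-- The difference is a sum of (1/c - 1)∇h; Abel summation uses that ∇h is of size N · `unitGap` and
its increments of size `unitGap`. -/
theorem abs_testFunction_sub_le {N x : ℕ} (c : ℕ → ℝ) (h1 : 1 ≤ x) (hx : x ≤ N) :
    |testFunction N c x - cosProfile N x| ≤
      2 * resistanceDeviation N c * ((N : ℝ) ^ 2 * unitGap N) := by
  have h : testFunction N c x - cosProfile N x =
      ∑ y ∈ Finset.Ico 1 x, (1 / c y - 1) * (cosProfile N (y + 1) - cosProfile N y) := by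
    rw [testFunction, eq_add_sum_sub (cosProfile N) h1]
    simp only [sub_mul, one_mul, Finset.sum_sub_distrib]
    ring
  rw [h]
  refine (abs_sum_mul_le (N := N) (M := N * resistanceDeviation N c) (B := N * unitGap N)
    (L := unitGap N) (fun m hm => abs_sum_resistance_sub_one_le c hm)
    (fun y _ hy => abs_cosProfile_succ_sub_le hy.le)
    (fun y _ _ => abs_cosProfile_second_difference_le N y)
    (mul_nonneg (Nat.cast_nonneg N) (unitGap_nonneg N)) (unitGap_nonneg N) hx).trans_eq ?_
  ring

theorem sum_cosProfile_sub_sq {N : ℕ} (hN : 2 ≤ N) :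
    ∑ y ∈ Finset.Ico 1 N, (cosProfile N (y + 1) - cosProfile N y) ^ 2 = unitGap N * (N / 2) := by
  -- The cosine is symmetric about 1/2, so its value at site 0 equals that at site 1 and `w 1`
  -- vanishes.
  let w : ℕ → ℝ := fun x => cosProfile N x - cosProfile N (x - 1)
  have hw : ∀ x, w (x + 1) = cosProfile N (x + 1) - cosProfile N x := fun x => rfl
  have hw' : ∀ x, w (x + 1) = -unitGap N * ∑ z ∈ Finset.Icc 1 x, cosProfile N z := fun x =>
    cosProfile_succ_sub N x
  have h := sum_mul_sub_by_parts (cosProfile N) w (m := N) (by omega)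
  have hw1 : w 1 = 0 := by simpa using hw' 0
  rw [hw1, hw' N, sum_cosProfile hN, Finset.sum_congr rfl (g := fun x =>
    -unitGap N * cosProfile N x ^ 2), ← Finset.mul_sum, sum_cosProfile_sq hN] at h
  · simp only [hw, ← sq] at h
    linarith
  · intro x hx
    obtain ⟨y, rfl⟩ : ∃ y, x = y + 1 := ⟨x - 1, by rw [Finset.mem_Icc] at hx; omega⟩
    rw [hw', hw', Finset.sum_Icc_succ_top (by omega)]
    ring

/-- The energy density is (∇h)²/c. Splitting 1/c = 1 + (1/c - 1) isolates the energy of the cosine;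
Abel summation against (∇h)² bounds the rest, with 3 = 1 + 2 from its size and its variation. -/
theorem dirichlet_testFunction_le {N : ℕ} (hN : 2 ≤ N) {c : ℕ → ℝ}
    (hc : ∀ x, 1 ≤ x → x < N → 0 < c x) :
    (N : ℝ) ^ 2 * dirichlet N c (testFunction N c) ≤ (N : ℝ) ^ 2 * unitGap N / 2 +
      3 * resistanceDeviation N c * ((N : ℝ) ^ 2 * unitGap N) ^ 2 := by
  have h0 : (N : ℝ) ≠ 0 := by positivity
  have hk := unitGap_nonneg N
  let w : ℕ → ℝ := fun y => cosProfile N (y + 1) - cosProfile N y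
  have hD : dirichlet N c (testFunction N c) = 1 / (N : ℝ) *
      (∑ y ∈ Finset.Ico 1 N, w y ^ 2 + ∑ y ∈ Finset.Ico 1 N, (1 / c y - 1) * w y ^ 2) := by
    rw [dirichlet_eq (by omega), ← Finset.sum_add_distrib]
    congr 1
    refine Finset.sum_congr rfl fun y hy => ?_
    rw [Finset.mem_Ico] at hy
    have := (hc y hy.1 hy.2).ne'
    rw [testFunction, testFunction, Finset.sum_Ico_succ_top hy.1]
    simp only [w]
    field_simp
    ring
  have hA := abs_sum_mul_le (N := N) (M := N * resistanceDeviation N c) (φ := fun y => w y ^ 2)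
    (B := (N * unitGap N) ^ 2) (L := unitGap N * (2 * (N * unitGap N)))
    (fun m hm => abs_sum_resistance_sub_one_le c hm)
    (fun y _ hy => by
      rw [abs_pow]
      exact pow_le_pow_left₀ (abs_nonneg _) (abs_cosProfile_succ_sub_le hy.le) 2)
    (fun y _ hy => by
      have e1 := abs_cosProfile_succ_sub_le hy.le
      have e2 := abs_cosProfile_succ_sub_le (N := N) (y := y) (by omega)
      rw [show w (y + 1) ^ 2 - w y ^ 2 = (w (y + 1) - w y) * (w (y + 1) + w y) by ring, abs_mul]
      exact mul_le_mul (abs_cosProfile_second_difference_le N y)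
        ((abs_add_le _ _).trans (by linarith)) (abs_nonneg _) hk)
    (by positivity) (by positivity) le_rfl
  have hA' := (le_abs_self _).trans hA
  rw [hD, sum_cosProfile_sub_sq hN]
  calc _ ≤ (N : ℝ) ^ 2 * (1 / (N : ℝ) * (unitGap N * (N / 2) + N * resistanceDeviation N c *
        ((N * unitGap N) ^ 2 + N * (unitGap N * (2 * (N * unitGap N)))))) := by gcongr
    _ = _ := by field_simp; ring

/-- The second moment loses at most 2η, by T² ≥ h² + 2h(T - h), and the mean is at most η in
absolute value because h has mean zero. -/
theorem variance_testFunction_ge {N : ℕ} (hN : 2 ≤ N) (c : ℕ → ℝ) {η : ℝ}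
    (hη : ∀ x, 1 ≤ x → x ≤ N → |testFunction N c x - cosProfile N x| ≤ η) :
    1 / 2 - 2 * η - η ^ 2 ≤ variance N (testFunction N c) := by
  have h0 : (0 : ℝ) < N := by positivity
  have hη0 : 0 ≤ η := (abs_nonneg _).trans (hη 1 le_rfl (by omega))
  have h1 : |∑ x ∈ Finset.Icc 1 N, testFunction N c x| ≤ N * η := by
    have := abs_sum_Icc_le le_rfl hη0 hη
    rwa [Finset.sum_sub_distrib, sum_cosProfile hN, sub_zero] at this
  have h2 : N / 2 - N * (2 * η) ≤ ∑ x ∈ Finset.Icc 1 N, testFunction N c x ^ 2 := by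
    have : ∑ x ∈ Finset.Icc 1 N, (cosProfile N x ^ 2 - 2 * η) ≤
        ∑ x ∈ Finset.Icc 1 N, testFunction N c x ^ 2 := by
      refine Finset.sum_le_sum fun x hx => ?_
      rw [Finset.mem_Icc] at hx
      have a1 := hη x hx.1 hx.2
      have a2 : |cosProfile N x * (testFunction N c x - cosProfile N x)| ≤ 1 * η := by
        rw [abs_mul]
        exact mul_le_mul (abs_cosProfile_le N x) a1 (abs_nonneg _) zero_le_one
      have a3 := neg_abs_le (cosProfile N x * (testFunction N c x - cosProfile N x))
      nlinarith [sq_nonneg (testFunction N c x - cosProfile N x)]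
    rw [Finset.sum_sub_distrib, sum_cosProfile_sq hN] at this
    simpa using this
  rw [variance_eq]
  have h3 : (1 / (N : ℝ) * ∑ x ∈ Finset.Icc 1 N, testFunction N c x) ^ 2 ≤ η ^ 2 := by
    rw [← sq_abs]
    refine pow_le_pow_left₀ (abs_nonneg _) ?_ 2
    rw [abs_mul, abs_of_pos (by positivity), one_div, inv_mul_le_iff₀ h0]
    exact h1
  have h4 : 1 / 2 - 2 * η ≤ 1 / (N : ℝ) * ∑ x ∈ Finset.Icc 1 N, testFunction N c x ^ 2 := by
    rw [one_div (N : ℝ), le_inv_mul_iff₀ h0]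
    linarith
  linarith

/-- The bound on `N² gap` obtained from the test function, in terms of the deviation `δ`. -/
noncomputable def gapBound (δ : ℝ) : ℝ :=
  (Real.pi ^ 2 / 2 + 3 * δ * (Real.pi ^ 2) ^ 2) /
    (1 / 2 - 2 * (2 * δ * Real.pi ^ 2) - (2 * δ * Real.pi ^ 2) ^ 2)

theorem sq_mul_gap_le {N : ℕ} (hN : 2 ≤ N) {c : ℕ → ℝ} (hc : ∀ x, 1 ≤ x → x < N → 0 < c x)
    (hpos : 0 < 1 / 2 - 2 * (2 * resistanceDeviation N c * Real.pi ^ 2) -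
      (2 * resistanceDeviation N c * Real.pi ^ 2) ^ 2) :
    (N : ℝ) ^ 2 * gap N c ≤ gapBound (resistanceDeviation N c) := by
  have hδ := resistanceDeviation_nonneg N c
  have hk : 0 ≤ (N : ℝ) ^ 2 * unitGap N := mul_nonneg (by positivity) (unitGap_nonneg N)
  have hv := variance_testFunction_ge hN c fun x h1 hx =>
    (abs_testFunction_sub_le c h1 hx).trans
      (mul_le_mul_of_nonneg_left (sq_mul_unitGap_le N) (by positivity))
  have hd : (N : ℝ) ^ 2 * dirichlet N c (testFunction N c) ≤
      Real.pi ^ 2 / 2 + 3 * resistanceDeviation N c * (Real.pi ^ 2) ^ 2 := by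
    refine (dirichlet_testFunction_le hN hc).trans ?_
    have := sq_mul_unitGap_le N
    gcongr
  obtain ⟨f, -, -, -, hmin⟩ := exists_minimizer hN c
  have hg := hmin _ (hpos.trans_le hv)
  calc (N : ℝ) ^ 2 * gap N c ≤ (N : ℝ) ^ 2 * (dirichlet N c (testFunction N c) /
        variance N (testFunction N c)) := by gcongr
    _ = (N : ℝ) ^ 2 * dirichlet N c (testFunction N c) / variance N (testFunction N c) := by ring
    _ ≤ _ := div_le_div₀ (by positivity) hd hpos hv

theorem tendsto_gapBound : Tendsto gapBound (𝓝 0) (𝓝 (Real.pi ^ 2)) := by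
  have : ContinuousAt gapBound 0 := by
    unfold gapBound
    exact ContinuousAt.div (by fun_prop) (by fun_prop) (by norm_num)
  have h := this.tendsto
  rwa [show gapBound 0 = Real.pi ^ 2 by simp [gapBound]] at h

/-! ### Grönwall comparison of eigenfunctions. -/

/-- A discrete Grönwall inequality with memory. -/
theorem discrete_gronwall {N : ℕ} {r e : ℕ → ℝ} {η μ : ℝ} (hr : ∀ y, 1 ≤ y → y < N → 0 ≤ r y)
    (hη : 0 ≤ η) (hμ : 0 ≤ μ)
    (h : ∀ x, 1 ≤ x → x ≤ N →
      e x ≤ η + ∑ y ∈ Finset.Ico 1 x, r y * (μ * ∑ z ∈ Finset.Icc 1 y, e z))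
    {x : ℕ} (h1 : 1 ≤ x) (hx : x ≤ N) :
    e x ≤ η * Real.exp (μ * N * ∑ y ∈ Finset.Ico 1 x, r y) := by
  -- The induction carries the bound for all earlier sites and for the right-hand side of the
  -- recursion; one step adds a single term and uses 1 + t ≤ exp t.
  suffices H : (∀ z, 1 ≤ z → z ≤ x → e z ≤ η * Real.exp (μ * N * ∑ y ∈ Finset.Ico 1 x, r y)) ∧
      η + ∑ y ∈ Finset.Ico 1 x, r y * (μ * ∑ z ∈ Finset.Icc 1 y, e z) ≤
        η * Real.exp (μ * N * ∑ y ∈ Finset.Ico 1 x, r y) from H.1 x h1 le_rfl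
  induction x, h1 using Nat.le_induction with
  | base =>
    refine ⟨fun z hz1 hz2 => ?_, by simp⟩
    obtain rfl : z = 1 := by omega
    simpa using h 1 le_rfl hx
  | succ x h1 ih =>
    obtain ⟨ih1, ih2⟩ := ih (by omega)
    set T := η * Real.exp (μ * N * ∑ y ∈ Finset.Ico 1 x, r y) with hT
    have hT0 : 0 ≤ T := by positivity
    have hrx := hr x h1 (by omega)
    have hp : 0 ≤ μ * N * r x := by positivity
    have hT' : η * Real.exp (μ * N * ∑ y ∈ Finset.Ico 1 (x + 1), r y) =
        T * Real.exp (μ * N * r x) := by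
      rw [Finset.sum_Ico_succ_top h1, mul_add, Real.exp_add, hT, ← mul_assoc]
    have hsum : ∑ z ∈ Finset.Icc 1 x, e z ≤ N * T := by
      refine (Finset.sum_le_card_nsmul _ _ T fun z hz => ?_).trans ?_
      · rw [Finset.mem_Icc] at hz
        exact ih1 z hz.1 hz.2
      · rw [nsmul_eq_mul, Nat.card_Icc, Nat.add_sub_cancel]
        have : (x : ℝ) ≤ N := by exact_mod_cast (by omega : x ≤ N)
        gcongr
    have h2 : η + ∑ y ∈ Finset.Ico 1 (x + 1), r y * (μ * ∑ z ∈ Finset.Icc 1 y, e z) ≤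
        T * Real.exp (μ * N * r x) := by
      rw [Finset.sum_Ico_succ_top h1, ← add_assoc]
      calc _ ≤ T + r x * (μ * (N * T)) := by gcongr
        _ = T * (μ * N * r x + 1) := by ring
        _ ≤ _ := mul_le_mul_of_nonneg_left (Real.add_one_le_exp _) hT0
    rw [hT']
    refine ⟨fun z hz1 hz2 => ?_, h2⟩
    rcases hz2.eq_or_lt with rfl | hlt
    · exact (h _ hz1 hx).trans h2
    · exact (ih1 z hz1 (by omega)).trans
        (le_mul_of_one_le_right hT0 (Real.one_le_exp hp))

theorem sum_resistance_le {N m : ℕ} (c : ℕ → ℝ) (hm : m ≤ N) :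
    ∑ y ∈ Finset.Ico 1 m, 1 / c y ≤ N * (1 + resistanceDeviation N c) := by
  have h := (le_abs_self _).trans (abs_sum_resistance_sub_one_le c hm)
  rw [Finset.sum_sub_distrib, Finset.sum_const, Nat.card_Ico, nsmul_eq_mul, mul_one] at h
  have : ((m - 1 : ℕ) : ℝ) ≤ N := by exact_mod_cast (by omega : m - 1 ≤ N)
  linarith

/-- Comparison of an eigenfunction for `c` with the solution `A` of the same recursion for unit
conductances. -/
theorem abs_eigenfunction_sub_le {N : ℕ} {c G A : ℕ → ℝ} {μ : ℝ}
    (hc : ∀ x, 1 ≤ x → x < N → 0 < c x) (hμ : 0 ≤ μ)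
    (hG : ∀ x ∈ Finset.Icc 1 N, generator N c G x = -μ * G x)
    (hA : ∀ x, A (x + 1) - A x = -μ * ∑ z ∈ Finset.Icc 1 x, A z)
    (h1 : G 1 = A 1) (hA2 : ∀ x, |A x| ≤ 2) {x : ℕ} (hx1 : 1 ≤ x) (hx : x ≤ N) :
    |G x - A x| ≤ 4 * resistanceDeviation N c * ((N : ℝ) ^ 2 * μ) *
      Real.exp ((N : ℝ) ^ 2 * μ * (1 + resistanceDeviation N c)) := by
  have hδ := resistanceDeviation_nonneg N c
  set δ := resistanceDeviation N c
  let W : ℕ → ℝ := fun y => A (y + 1) - A y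
  have hWb : ∀ y, y ≤ N → |W y| ≤ μ * (N * 2) := fun y hy => by
    simp only [W]
    rw [hA, abs_mul, abs_neg, abs_of_nonneg hμ]
    exact mul_le_mul_of_nonneg_left (abs_sum_Icc_le hy zero_le_two fun x _ _ => hA2 x) hμ
  have hWd : ∀ y, |W (y + 1) - W y| ≤ μ * 2 := fun y => by
    simp only [W]
    rw [hA, hA, Finset.sum_Icc_succ_top (by omega),
      show ∀ a b k : ℝ, -k * (a + b) - -k * a = -k * b by intros; ring, abs_mul, abs_neg,
      abs_of_nonneg hμ]
    exact mul_le_mul_of_nonneg_left (hA2 _) hμ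
  have hrec : ∀ x, 1 ≤ x → x ≤ N → |G x - A x| ≤ N * δ * (μ * (N * 2) + N * (μ * 2)) +
      ∑ y ∈ Finset.Ico 1 x, 1 / c y * (μ * ∑ z ∈ Finset.Icc 1 y, |G z - A z|) := by
    intro x hx1 hx
    -- The first sum is the forcing due to the conductances, small by Abel summation; the second is
    -- the memory term for Grönwall.
    have hEq : G x - A x = ∑ y ∈ Finset.Ico 1 x, (1 / c y - 1) * W y +
        ∑ y ∈ Finset.Ico 1 x, 1 / c y * (-μ * ∑ z ∈ Finset.Icc 1 y, (G z - A z)) := by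
      rw [eq_add_sum_sub G hx1, eq_add_sum_sub A hx1, h1, add_sub_add_left_eq_sub,
        ← Finset.sum_sub_distrib, ← Finset.sum_add_distrib]
      refine Finset.sum_congr rfl fun y hy => ?_
      rw [Finset.mem_Ico] at hy
      rw [eigenfunction_succ hc hG hy.1 (by omega), Finset.sum_sub_distrib]
      simp only [W]
      rw [hA]
      ring
    rw [hEq]
    refine (abs_add_le _ _).trans (add_le_add ?_ ?_)
    · exact abs_sum_mul_le (fun m hm => abs_sum_resistance_sub_one_le c hm)
        (fun y _ hy => hWb y hy.le) (fun y _ _ => hWd y) (by positivity) (by positivity) hx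
    · refine (Finset.abs_sum_le_sum_abs _ _).trans (Finset.sum_le_sum fun y hy => ?_)
      rw [Finset.mem_Ico] at hy
      have := hc y hy.1 (by omega)
      rw [abs_mul, abs_mul, abs_neg, abs_of_nonneg hμ, abs_of_pos (by positivity)]
      gcongr
      exact Finset.abs_sum_le_sum_abs _ _
  refine (discrete_gronwall (e := fun x => |G x - A x|)
    (fun y h1 h2 => (one_div_pos.2 (hc y h1 h2)).le) (by positivity) hμ hrec hx1 hx).trans ?_
  have hR := sum_resistance_le c hx
  calc _ ≤ N * δ * (μ * (N * 2) + N * (μ * 2)) * Real.exp (μ * N * (N * (1 + δ))) := by gcongr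
    _ = _ := by ring_nf

/-! ### The angle of the gap. -/

/-- The angle `θ` with `4 sin² (θ / 2)` equal to the gap. -/
noncomputable def gapAngle (N : ℕ) (c : ℕ → ℝ) : ℝ := 2 * Real.arcsin (√(gap N c) / 2)

theorem two_sin_gapAngle {N : ℕ} {c : ℕ → ℝ} (h : gap N c ≤ 1) :
    2 * Real.sin (gapAngle N c / 2) = √(gap N c) := by
  have h1 : √(gap N c) ≤ 1 := Real.sqrt_le_one.2 h
  have h2 := Real.sqrt_nonneg (gap N c)
  rw [gapAngle, mul_div_cancel_left₀ _ (two_ne_zero' ℝ), Real.sin_arcsin (by linarith) (by linarith)]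
  ring

theorem four_sin_sq_gapAngle {N : ℕ} {c : ℕ → ℝ} (h0 : 0 ≤ gap N c) (h : gap N c ≤ 1) :
    4 * Real.sin (gapAngle N c / 2) ^ 2 = gap N c := by
  rw [← Real.sq_sqrt h0, ← two_sin_gapAngle h]
  ring

theorem gapAngle_pos {N : ℕ} {c : ℕ → ℝ} (h : 0 < gap N c) : 0 < gapAngle N c := by
  have := Real.sqrt_pos.2 h
  have := Real.arcsin_pos.2 (half_pos this)
  unfold gapAngle
  positivity

/-- Here cos² = 1 - gap/4 ≥ 3/4. This keeps `angleProfile` bounded by 2. -/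
theorem half_le_cos_gapAngle {N : ℕ} {c : ℕ → ℝ} (h0 : 0 ≤ gap N c) (h : gap N c ≤ 1) :
    1 / 2 ≤ Real.cos (gapAngle N c / 2) := by
  have h1 := four_sin_sq_gapAngle h0 h
  have h2 := Real.sin_sq_add_cos_sq (gapAngle N c / 2)
  have h3 : 0 ≤ Real.cos (gapAngle N c / 2) := by
    rw [gapAngle, mul_div_cancel_left₀ _ (two_ne_zero' ℝ)]
    exact Real.cos_arcsin_nonneg _
  nlinarith

/-- The solution of the eigenvalue equation for unit conductances at the eigenvalue `gap N c`. -/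
noncomputable def angleProfile (N : ℕ) (c : ℕ → ℝ) (x : ℕ) : ℝ :=
  Real.cos (gapAngle N c * ((x : ℝ) - 1 / 2)) / Real.cos (gapAngle N c / 2)

/-- Bound for the distance to `angleProfile` when `N² gap ≤ U`. -/
noncomputable def comparisonError (δ U : ℝ) : ℝ := 4 * δ * U * Real.exp (U * (1 + δ))

theorem abs_sub_angleProfile_le {N : ℕ} {c g : ℕ → ℝ} {U : ℝ}
    (hc : ∀ x, 1 ≤ x → x < N → 0 < c x) (hg : IsPrincipalEigenfunction N c g)
    (h0 : 0 ≤ gap N c) (h : gap N c ≤ 1) (hU : (N : ℝ) ^ 2 * gap N c ≤ U) {x : ℕ}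
    (hx1 : 1 ≤ x) (hx : x ≤ N) :
    |g x - angleProfile N c x| ≤ comparisonError (resistanceDeviation N c) U := by
  have hk := half_le_cos_gapAngle h0 h
  have hδ := resistanceDeviation_nonneg N c
  refine (abs_eigenfunction_sub_le (A := angleProfile N c) hc h0 hg.1 (fun y => ?_) ?_
    (fun y => ?_) hx1 hx).trans ?_
  · simp only [angleProfile]
    rw [← sub_div, cos_succ_sub_eq_sum, four_sin_sq_gapAngle h0 h, ← Finset.sum_div]
    ring
  · rw [hg.2, angleProfile, show gapAngle N c * (((1 : ℕ) : ℝ) - 1 / 2) = gapAngle N c / 2 by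
      push_cast; ring, div_self (by linarith)]
  · rw [angleProfile, abs_div, abs_of_pos (by linarith : 0 < Real.cos (gapAngle N c / 2)),
      div_le_iff₀ (by linarith)]
    linarith [Real.abs_cos_le_one (gapAngle N c * ((y : ℝ) - 1 / 2))]
  · unfold comparisonError
    have hU0 : 0 ≤ U := (by positivity : 0 ≤ (N : ℝ) ^ 2 * gap N c).trans hU
    gcongr

/-- The vanishing of the mean of the eigenfunction forces `N θ` close to a zero of the sine. -/
theorem abs_sin_gapAngle_le {N : ℕ} (hN : 2 ≤ N) {c : ℕ → ℝ} {U : ℝ}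
    (hc : ∀ x, 1 ≤ x → x < N → 0 < c x) (h : gap N c ≤ 1) (hU : (N : ℝ) ^ 2 * gap N c ≤ U) :
    |Real.sin (N * gapAngle N c)| ≤
      comparisonError (resistanceDeviation N c) U * (N * gapAngle N c) := by
  have h0 := gap_pos hN hc
  obtain ⟨g, hg⟩ := exists_principalEigenfunction hN hc
  have hk := half_le_cos_gapAngle h0.le h
  have hθ := gapAngle_pos h0
  have hcmp := fun x h1 hx => abs_sub_angleProfile_le (x := x) hc hg h0.le h hU h1 hx
  have hE : 0 ≤ comparisonError (resistanceDeviation N c) U :=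
    (abs_nonneg _).trans (hcmp 1 le_rfl (by omega))
  have hsum := abs_sum_Icc_le le_rfl hE hcmp
  rw [Finset.sum_sub_distrib, hg.sum_eq_zero hN hc, zero_sub, abs_neg] at hsum
  -- The normalising factor cos(θ/2) turns 2 sin(θ/2) into sin θ in the telescoped cosine sum.
  have hs : Real.sin (N * gapAngle N c) =
      Real.sin (gapAngle N c) * ∑ z ∈ Finset.Icc 1 N, angleProfile N c z := by
    have h2 := Real.sin_two_mul (gapAngle N c / 2)
    rw [mul_div_cancel₀ _ (two_ne_zero' ℝ)] at h2
    rw [mul_comm, ← two_sin_mul_sum_cos, h2]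
    simp only [angleProfile]
    rw [← Finset.sum_div]
    have : Real.cos (gapAngle N c / 2) ≠ 0 := by linarith
    field_simp
  rw [hs, abs_mul]
  calc _ ≤ gapAngle N c * (N * comparisonError (resistanceDeviation N c) U) :=
        mul_le_mul (Real.abs_sin_le_abs.trans_eq (abs_of_pos hθ)) hsum (abs_nonneg _) hθ.le
    _ = _ := by ring

theorem supSites_nonneg (N : ℕ) (u : ℕ → ℝ) : 0 ≤ supSites N u := by
  refine Real.sSup_nonneg ?_
  rintro _ ⟨x, -, rfl⟩
  exact abs_nonneg _

theorem supSites_le {N : ℕ} {u : ℕ → ℝ} {B : ℝ} (hB : 0 ≤ B)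
    (h : ∀ x, 1 ≤ x → x ≤ N → |u x| ≤ B) : supSites N u ≤ B := by
  refine Real.sSup_le ?_ hB
  rintro _ ⟨x, hx, rfl⟩
  exact h x hx.1 hx.2

/-! ### Passage to the limit. -/

section Limits

variable {c : ℕ → ℕ → ℝ}

theorem eventually_sq_mul_gap_le (hc : ∀ N x : ℕ, 1 ≤ x → x < N → 0 < c N x)
    (hδ : Tendsto (fun N : ℕ => resistanceDeviation N (c N)) atTop (𝓝 0)) :
    ∀ᶠ N : ℕ in atTop, (N : ℝ) ^ 2 * gap N (c N) ≤ gapBound (resistanceDeviation N (c N)) := by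
  have h1 : ContinuousAt (fun δ : ℝ => 1 / 2 - 2 * (2 * δ * Real.pi ^ 2) -
      (2 * δ * Real.pi ^ 2) ^ 2) 0 := by fun_prop
  have h2 := (h1.tendsto.comp hδ).eventually_const_lt (u := 0) (by norm_num)
  filter_upwards [h2, eventually_ge_atTop 2] with N h2 hN
  exact sq_mul_gap_le hN (hc N) h2

theorem tendsto_gap (hc : ∀ N x : ℕ, 1 ≤ x → x < N → 0 < c N x)
    (hδ : Tendsto (fun N : ℕ => resistanceDeviation N (c N)) atTop (𝓝 0)) :
    Tendsto (fun N : ℕ => gap N (c N)) atTop (𝓝 0) := by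
  have hlim : Tendsto (fun N : ℕ => gapBound (resistanceDeviation N (c N)) / (N : ℝ) ^ 2)
      atTop (𝓝 0) := (tendsto_gapBound.comp hδ).div_atTop
        ((tendsto_pow_atTop two_ne_zero).comp tendsto_natCast_atTop_atTop)
  refine squeeze_zero' ?_ ?_ hlim
  · filter_upwards [eventually_ge_atTop 2] with N hN
    exact (gap_pos hN (hc N)).le
  · filter_upwards [eventually_ge_atTop 2, eventually_sq_mul_gap_le hc hδ] with N hN h
    rw [le_div_iff₀ (by positivity)]
    linarith

theorem tendsto_gapAngle (hc : ∀ N x : ℕ, 1 ≤ x → x < N → 0 < c N x)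
    (hδ : Tendsto (fun N : ℕ => resistanceDeviation N (c N)) atTop (𝓝 0)) :
    Tendsto (fun N : ℕ => gapAngle N (c N)) atTop (𝓝 0) := by
  have h : Continuous fun t : ℝ => 2 * Real.arcsin (√t / 2) := by fun_prop
  have h0 := h.tendsto 0
  simp only [Real.sqrt_zero, zero_div, Real.arcsin_zero, mul_zero] at h0
  exact h0.comp (tendsto_gap hc hδ)

theorem tendsto_comparisonError
    (hδ : Tendsto (fun N : ℕ => resistanceDeviation N (c N)) atTop (𝓝 0)) :
    Tendsto (fun N : ℕ => comparisonError (resistanceDeviation N (c N))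
      (gapBound (resistanceDeviation N (c N)))) atTop (𝓝 0) := by
  have hU := tendsto_gapBound.comp hδ
  have h1 := (hδ.const_mul 4).mul hU
  have h2 := (Real.continuous_exp.tendsto _).comp (hU.mul (hδ.const_add 1))
  simpa [comparisonError] using h1.mul h2

theorem tendsto_sinc_gapAngle (hc : ∀ N x : ℕ, 1 ≤ x → x < N → 0 < c N x)
    (hδ : Tendsto (fun N : ℕ => resistanceDeviation N (c N)) atTop (𝓝 0)) :
    Tendsto (fun N : ℕ => Real.sinc (gapAngle N (c N) / 2)) atTop (𝓝 1) := by
  have h := (Real.continuous_sinc.tendsto (0 / 2)).comp ((tendsto_gapAngle hc hδ).div_const 2)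
  rwa [zero_div, Real.sinc_zero] at h

/-- Converts between N√gap and Nθ, up to a factor tending to one. -/
theorem eventually_sqrt_gap_eq (hc : ∀ N x : ℕ, 1 ≤ x → x < N → 0 < c N x)
    (hδ : Tendsto (fun N : ℕ => resistanceDeviation N (c N)) atTop (𝓝 0)) :
    ∀ᶠ N : ℕ in atTop,
      √(gap N (c N)) = gapAngle N (c N) * Real.sinc (gapAngle N (c N) / 2) := by
  filter_upwards [eventually_ge_atTop 2, (tendsto_gap hc hδ).eventually_le_const one_pos]
    with N hN h
  have hθ := gapAngle_pos (gap_pos hN (hc N))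
  rw [← two_sin_gapAngle h, Real.sinc_of_ne_zero (by positivity)]
  field_simp

/-- Values where the cardinal sine nearly vanishes and which are asymptotically at most `π`
converge to `π`. -/
theorem tendsto_pi_of_sinc {s e B : ℕ → ℝ} (h0 : ∀ᶠ N in atTop, 0 < s N)
    (hs : ∀ᶠ N in atTop, |Real.sin (s N)| ≤ e N * s N) (hB : ∀ᶠ N in atTop, s N ≤ B N)
    (he : Tendsto e atTop (𝓝 0)) (hBlim : Tendsto B atTop (𝓝 Real.pi)) :
    Tendsto s atTop (𝓝 Real.pi) := by
  refine tendsto_order.2 ⟨fun a ha => ?_, fun a ha => ?_⟩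
  -- On this compact interval inside [0, π) sinc has a positive minimum, while sinc(s) ≤ e tends to
  -- zero. The factor s in the bound on the sine is what excludes s near 0; the maximum covers
  -- negative `a`.
  · have hpos : ∀ x ∈ Set.Icc 0 (max a 0), 0 < Real.sinc x := by
      intro x hx
      rcases hx.1.eq_or_lt with rfl | hx0
      · simp
      · rw [Real.sinc_of_ne_zero hx0.ne']
        exact div_pos (Real.sin_pos_of_pos_of_lt_pi hx0
          (hx.2.trans_lt (max_lt ha Real.pi_pos))) hx0
    obtain ⟨x₀, hx₀, hmin⟩ := isCompact_Icc.exists_isMinOn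
      (⟨0, le_rfl, le_max_right a 0⟩ : (Set.Icc 0 (max a 0)).Nonempty)
      Real.continuous_sinc.continuousOn
    filter_upwards [h0, hs, he.eventually_lt_const (hpos x₀ hx₀)] with N h0 hs he
    by_contra hcon
    have h1 : Real.sinc x₀ ≤ Real.sinc (s N) :=
      hmin ⟨h0.le, (not_lt.1 hcon).trans (le_max_left a 0)⟩
    rw [Real.sinc_of_ne_zero h0.ne' (x := s N), le_div_iff₀ h0] at h1
    nlinarith [le_abs_self (Real.sin (s N))]
  · filter_upwards [hB, hBlim.eventually_lt_const ha] with N h1 h2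
    exact h1.trans_lt h2

theorem tendsto_mul_gapAngle (hc : ∀ N x : ℕ, 1 ≤ x → x < N → 0 < c N x)
    (hδ : Tendsto (fun N : ℕ => resistanceDeviation N (c N)) atTop (𝓝 0)) :
    Tendsto (fun N : ℕ => (N : ℝ) * gapAngle N (c N)) atTop (𝓝 Real.pi) := by
  have hsinc := tendsto_sinc_gapAngle hc hδ
  have hBlim : Tendsto (fun N : ℕ => √(gapBound (resistanceDeviation N (c N))) /
      Real.sinc (gapAngle N (c N) / 2)) atTop (𝓝 Real.pi) := by
    have h := (tendsto_gapBound.comp hδ).sqrt.div hsinc one_ne_zero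
    rwa [Real.sqrt_sq Real.pi_pos.le, div_one] at h
  refine tendsto_pi_of_sinc ?_ ?_ ?_ (tendsto_comparisonError hδ) hBlim
  · filter_upwards [eventually_ge_atTop 2] with N hN
    have := gapAngle_pos (gap_pos hN (hc N))
    positivity
  · filter_upwards [eventually_ge_atTop 2, (tendsto_gap hc hδ).eventually_le_const one_pos,
      eventually_sq_mul_gap_le hc hδ] with N hN h1 hU
    exact abs_sin_gapAngle_le hN (hc N) h1 hU
  · filter_upwards [eventually_ge_atTop 2, hsinc.eventually_const_lt one_pos,
      eventually_sqrt_gap_eq hc hδ, eventually_sq_mul_gap_le hc hδ] with N hN h1 h2 hU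
    rw [le_div_iff₀ h1, mul_assoc, ← h2]
    refine Real.le_sqrt_of_sq_le ?_
    rw [mul_pow]
    rwa [Real.sq_sqrt (gap_pos hN (hc N)).le]

theorem tendsto_sq_mul_gap (hc : ∀ N x : ℕ, 1 ≤ x → x < N → 0 < c N x)
    (hδ : Tendsto (fun N : ℕ => resistanceDeviation N (c N)) atTop (𝓝 0)) :
    Tendsto (fun N : ℕ => (N : ℝ) ^ 2 * gap N (c N)) atTop (𝓝 (Real.pi ^ 2)) := by
  have h := ((tendsto_mul_gapAngle hc hδ).mul (tendsto_sinc_gapAngle hc hδ)).pow 2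
  rw [mul_one] at h
  refine h.congr' ?_
  filter_upwards [eventually_ge_atTop 2, eventually_sqrt_gap_eq hc hδ] with N hN h
  rw [mul_assoc, ← h, mul_pow, Real.sq_sqrt (gap_pos hN (hc N)).le]

theorem tendsto_sq_mul_unitGap :
    Tendsto (fun N : ℕ => (N : ℝ) ^ 2 * unitGap N) atTop (𝓝 (Real.pi ^ 2)) := by
  have h1 : Tendsto (fun N : ℕ => Real.pi / N / 2) atTop (𝓝 (0 / 2)) :=
    (tendsto_const_div_atTop_nhds_zero_nat Real.pi).div_const 2
  have h2 := (((Real.continuous_sinc.tendsto _).comp h1).pow 2).const_mul (Real.pi ^ 2)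
  rw [zero_div, Real.sinc_zero, one_pow, mul_one] at h2
  refine h2.congr' ?_
  filter_upwards [eventually_ge_atTop 2] with N hN
  have h0 : (0 : ℝ) < N := by positivity
  have := Real.pi_pos
  simp only [Function.comp, unitGap]
  rw [Real.sinc_of_ne_zero (by positivity)]
  field_simp
  ring

/-- The first term is the cost of the normalisation; the second comes from the cosine being
1-Lipschitz and (x - 1/2)/N ≤ 1. -/
theorem abs_angleProfile_sub_cosProfile_le {N x : ℕ} (c : ℕ → ℝ) (h1 : 1 ≤ x) (hx : x ≤ N) :
    |angleProfile N c x - cosProfile N x| ≤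
      |(Real.cos (gapAngle N c / 2))⁻¹ - 1| + |N * gapAngle N c - Real.pi| := by
  have hN : (0 : ℝ) < N := by exact_mod_cast (by omega : 0 < N)
  have hx1 : (1 : ℝ) ≤ x := by exact_mod_cast h1
  have hxN : (x : ℝ) ≤ N := by exact_mod_cast hx
  set a := gapAngle N c * ((x : ℝ) - 1 / 2)
  set b := Real.pi / N * ((x : ℝ) - 1 / 2)
  have h2 : |Real.cos a - Real.cos b| ≤ |a - b| := by
    simpa [Real.dist_eq] using Real.lipschitzWith_cos.dist_le_mul a b
  have h3 : |a - b| ≤ |N * gapAngle N c - Real.pi| := by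
    rw [show a - b = (N * gapAngle N c - Real.pi) * (((x : ℝ) - 1 / 2) / N) by
      simp only [a, b]; field_simp, abs_mul]
    refine mul_le_of_le_one_right (abs_nonneg _) ?_
    rw [abs_of_nonneg (div_nonneg (by linarith) hN.le), div_le_one hN]
    linarith
  rw [cosProfile_eq, angleProfile, show Real.cos a / Real.cos (gapAngle N c / 2) - Real.cos b =
    Real.cos a * ((Real.cos (gapAngle N c / 2))⁻¹ - 1) + (Real.cos a - Real.cos b) by ring]
  refine (abs_add_le _ _).trans (add_le_add ?_ (h2.trans h3))
  rw [abs_mul]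
  exact mul_le_of_le_one_left (abs_nonneg _) (Real.abs_cos_le_one a)

/-- Bound for the uniform distance between the principal eigenfunction and the cosine. -/
noncomputable def profileError (N : ℕ) (c : ℕ → ℝ) : ℝ :=
  comparisonError (resistanceDeviation N c) (gapBound (resistanceDeviation N c)) +
    (|(Real.cos (gapAngle N c / 2))⁻¹ - 1| + |N * gapAngle N c - Real.pi|)

theorem tendsto_profileError (hc : ∀ N x : ℕ, 1 ≤ x → x < N → 0 < c N x)
    (hδ : Tendsto (fun N : ℕ => resistanceDeviation N (c N)) atTop (𝓝 0)) :
    Tendsto (fun N : ℕ => profileError N (c N)) atTop (𝓝 0) := by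
  have h1 := (Real.continuous_cos.tendsto _).comp ((tendsto_gapAngle hc hδ).div_const 2)
  rw [zero_div, Real.cos_zero] at h1
  have h2 := ((h1.inv₀ one_ne_zero).sub_const 1).abs
  have h3 := ((tendsto_mul_gapAngle hc hδ).sub_const Real.pi).abs
  simpa [profileError] using (tendsto_comparisonError hδ).add (h2.add h3)

theorem eventually_abs_sub_cosProfile_le (hc : ∀ N x : ℕ, 1 ≤ x → x < N → 0 < c N x)
    (hδ : Tendsto (fun N : ℕ => resistanceDeviation N (c N)) atTop (𝓝 0)) {g : ℕ → ℕ → ℝ}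
    (hg : ∀ N : ℕ, 2 ≤ N → IsPrincipalEigenfunction N (c N) (g N)) :
    ∀ᶠ N : ℕ in atTop, ∀ x, 1 ≤ x → x ≤ N →
      |g N x - cosProfile N x| ≤ profileError N (c N) := by
  filter_upwards [eventually_ge_atTop 2, (tendsto_gap hc hδ).eventually_le_const one_pos,
      eventually_sq_mul_gap_le hc hδ] with N hN h1 hU x hx1 hx
  exact (abs_sub_le _ _ _).trans (add_le_add
    (abs_sub_angleProfile_le (hc N) (hg N hN) (gap_pos hN (hc N)).le h1 hU hx1 hx)
    (abs_angleProfile_sub_cosProfile_le (c N) hx1 hx))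

theorem tendsto_supSites_sub (hc : ∀ N x : ℕ, 1 ≤ x → x < N → 0 < c N x)
    (hδ : Tendsto (fun N : ℕ => resistanceDeviation N (c N)) atTop (𝓝 0)) {g : ℕ → ℕ → ℝ}
    (hg : ∀ N : ℕ, 2 ≤ N → IsPrincipalEigenfunction N (c N) (g N)) :
    Tendsto (fun N : ℕ => supSites N (fun x => g N x - cosProfile N x)) atTop (𝓝 0) := by
  refine squeeze_zero' (Eventually.of_forall fun N => supSites_nonneg _ _) ?_
    (tendsto_profileError hc hδ)
  filter_upwards [eventually_ge_atTop 2, eventually_abs_sub_cosProfile_le hc hδ hg] with N hN h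
  exact supSites_le ((abs_nonneg _).trans (h 1 le_rfl (by omega))) h

/-- Both fluxes are minus an eigenvalue times a partial sum, so only the sums and the eigenvalues
need comparing. -/
theorem abs_wgrad_sub_le {N : ℕ} {c g : ℕ → ℝ} {E : ℝ}
    (hg : IsPrincipalEigenfunction N c g) (h0 : 0 ≤ gap N c) (hE0 : 0 ≤ E)
    (hE : ∀ x, 1 ≤ x → x ≤ N → |g x - cosProfile N x| ≤ E) {x : ℕ} (hx1 : 1 ≤ x) (hx : x ≤ N) :
    |N * wgrad N c g x - N * wgrad N (fun _ => 1) (cosProfile N) x| ≤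
      (N : ℝ) ^ 2 * gap N c * E + |(N : ℝ) ^ 2 * gap N c - (N : ℝ) ^ 2 * unitGap N| := by
  obtain rfl | ⟨y, rfl, hy⟩ : x = 1 ∨ ∃ y, x = y + 1 ∧ 1 ≤ y := by
    rcases hx1.eq_or_lt with h | h
    · exact Or.inl h.symm
    · exact Or.inr ⟨x - 1, by omega, by omega⟩
  · rw [wgrad_one, wgrad_one, sub_self, abs_zero]
    positivity
  rw [wgrad_eq_neg_mul_sum hg.1 (by omega), wgrad_succ _ _ hy (by omega), one_mul,
    cosProfile_succ_sub]
  have h1 : |∑ z ∈ Finset.Icc 1 y, (g z - cosProfile N z)| ≤ N * E :=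
    abs_sum_Icc_le (by omega) hE0 fun z h1 h2 => hE z h1 (by omega)
  have h2 : |∑ z ∈ Finset.Icc 1 y, cosProfile N z| ≤ N * 1 :=
    abs_sum_Icc_le (by omega) zero_le_one fun z _ _ => abs_cosProfile_le N z
  rw [Finset.sum_sub_distrib] at h1
  set S := ∑ z ∈ Finset.Icc 1 y, g z
  set H := ∑ z ∈ Finset.Icc 1 y, cosProfile N z
  rw [show N * (-gap N c * S) - N * (-unitGap N * H) =
    -(N * gap N c * (S - H)) - N * (gap N c - unitGap N) * H by ring]
  refine (abs_sub _ _).trans (add_le_add ?_ ?_)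
  · rw [abs_neg, abs_mul, abs_of_nonneg (by positivity : 0 ≤ N * gap N c)]
    calc _ ≤ N * gap N c * (N * E) := by gcongr
      _ = _ := by ring
  · rw [abs_mul, ← mul_sub, abs_mul, abs_mul, abs_of_nonneg (Nat.cast_nonneg N : (0 : ℝ) ≤ N),
      abs_of_nonneg (by positivity : (0 : ℝ) ≤ (N : ℝ) ^ 2)]
    calc _ ≤ N * |gap N c - unitGap N| * (N * 1) := by gcongr
      _ = _ := by ring

theorem tendsto_supSites_wgrad_sub (hc : ∀ N x : ℕ, 1 ≤ x → x < N → 0 < c N x)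
    (hδ : Tendsto (fun N : ℕ => resistanceDeviation N (c N)) atTop (𝓝 0)) {g : ℕ → ℕ → ℝ}
    (hg : ∀ N : ℕ, 2 ≤ N → IsPrincipalEigenfunction N (c N) (g N)) :
    Tendsto (fun N : ℕ => supSites N (fun x => (N : ℝ) * wgrad N (c N) (g N) x -
      (N : ℝ) * wgrad N (fun _ => 1) (cosProfile N) x)) atTop (𝓝 0) := by
  have hlim := ((tendsto_sq_mul_gap hc hδ).mul (tendsto_profileError hc hδ)).add
    ((tendsto_sq_mul_gap hc hδ).sub tendsto_sq_mul_unitGap).abs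
  rw [mul_zero, sub_self, abs_zero, zero_add] at hlim
  refine squeeze_zero' (Eventually.of_forall fun N => supSites_nonneg _ _) ?_ hlim
  filter_upwards [eventually_ge_atTop 2, eventually_abs_sub_cosProfile_le hc hδ hg] with N hN h
  have h0 := (gap_pos hN (hc N)).le
  have hE : 0 ≤ profileError N (c N) := (abs_nonneg _).trans (h 1 le_rfl (by omega))
  exact supSites_le (by positivity) fun x hx1 hx => abs_wgrad_sub_le (hg N hN) h0 hE h hx1 hx

end Limits

end RandomConductance

theorem theorem1p3 (c : ℕ → ℕ → ℝ)
    (hc : ∀ N x : ℕ, 1 ≤ x → x < N → 0 < c N x)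
    (hLLN : Tendsto (fun N : ℕ => RandomConductance.resistanceDeviation N (c N)) atTop (𝓝 0)) :
    Tendsto (fun N : ℕ => (N : ℝ) ^ 2 * RandomConductance.gap N (c N) / Real.pi ^ 2)
        atTop (𝓝 1) ∧
    (∀ N : ℕ, 2 ≤ N → ∃ g : ℕ → ℝ, RandomConductance.IsPrincipalEigenfunction N (c N) g ∧
      ∀ g' : ℕ → ℝ, RandomConductance.IsPrincipalEigenfunction N (c N) g' →
        ∀ x ∈ Finset.Icc 1 N, g' x = g x) ∧
    ∀ g : ℕ → ℕ → ℝ,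
      (∀ N : ℕ, 2 ≤ N → RandomConductance.IsPrincipalEigenfunction N (c N) (g N)) →
      Tendsto (fun N : ℕ => RandomConductance.supSites N
          (fun x => g N x - RandomConductance.cosProfile N x)) atTop (𝓝 0) ∧
      Tendsto (fun N : ℕ => RandomConductance.supSites N
          (fun x => (N : ℝ) * RandomConductance.wgrad N (c N) (g N) x -
            (N : ℝ) * RandomConductance.wgrad N (fun _ => 1) (RandomConductance.cosProfile N) x))
        atTop (𝓝 0) := by
  refine ⟨?_, fun N hN => ?_, fun g hg => ⟨?_, ?_⟩⟩
  · have h := (RandomConductance.tendsto_sq_mul_gap hc hLLN).div_const (Real.pi ^ 2)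
    rwa [div_self (pow_ne_zero 2 Real.pi_ne_zero)] at h
  · obtain ⟨g, hg⟩ := RandomConductance.exists_principalEigenfunction hN (hc N)
    exact ⟨g, hg, fun g' hg' x hx => RandomConductance.eigenfunction_unique (hc N) hg'.1 hg.1
      (hg'.2.trans hg.2.symm) hx⟩
  · exact RandomConductance.tendsto_supSites_sub hc hLLN hg
  · exact RandomConductance.tendsto_supSites_wgrad_sub hc hLLN hg
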